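/- Let $0<b<\infty$ and $\sigma\in L_2(0,b)$. Let $L$ be the operator in $L_2(0,b)$ given by $Ly=-i\frac{dy}{dx}$ on the domain $$D(L)=\Big\{y\in W_2^1[0,b] : y(0)-\int_0^b\Big(-i\frac{dy}{dx}\Big)\overline{\sigma(x)}\,dx=0\Big\},$$ where $W_2^1[0,b]$ is the space of absolutely continuous functions on $[0,b]$ whose derivative lies in $L_2(0,b)$. Define $$\Delta(\lambda)=1-\lambda\int_0^b e^{i\lambda x}\,\overline{\sigma(x)}\,dx,\qquad \lambda\in\mathbb C.$$ Then $\Delta$ is an entire function, not identically zero; the spectrum of $L$ is exactly the set of zeros of $\Delta$, and it consists of eigenvalues. For every $\lambda\in\mathbb C$, the algebraic multiplicity $\dim\bigcup_{n\ge 1}\ker(L-\lambda I)^n$ equals the order of vanishing of $\Delta$ at $\lambda$ (both are $0$ if $\Delta(\lambda)\neq 0$); in particular, the algebraic multiplicity of each eigenvalue of $L$ is finite and equals its order as a zero of $\Delta$. -/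

import Mathlib

open MeasureTheory
open scoped ComplexConjugate

noncomputable section

namespace SegmentOperator

/-! ### Spectral notions for a linear operator defined on a subspace of a complex Banach space -/

section Spectral

variable {E : Type*} [NormedAddCommGroup E] [NormedSpace ℂ E]

/-- The resolvent set of `A`: those `z` for which `A - z I : D(A) → E` has a bounded everywhere
defined two-sided inverse `R`. -/
def resolventSet (A : E →ₗ.[ℂ] E) : Set ℂ :=
  {z | ∃ R : E →L[ℂ] E,
    (∀ f : E, ∃ h : R f ∈ A.domain, A ⟨R f, h⟩ - z • R f = f) ∧
    ∀ y : A.domain, R (A y - z • (y : E)) = y}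

/-- The spectrum of `A`, the complement of the resolvent set. -/
def spectrum (A : E →ₗ.[ℂ] E) : Set ℂ := (resolventSet A)ᶜ

/-- `z` is an eigenvalue of `A`. -/
def IsEigenvalue (A : E →ₗ.[ℂ] E) (z : ℂ) : Prop :=
  ∃ y : A.domain, (y : E) ≠ 0 ∧ A y = z • (y : E)

/-- The kernel of `(A - z I) ^ n`, on its natural domain: `y ∈ ker (A - z I) ^ (n + 1)` iff
`y ∈ D(A)` and `A y - z y ∈ ker (A - z I) ^ n`. -/
def kerPow (A : E →ₗ.[ℂ] E) (z : ℂ) : ℕ → Submodule ℂ E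
  | 0 => ⊥
  | n + 1 => ((kerPow A z n).comap (A.toFun - z • A.domain.subtype)).map A.domain.subtype

/-- The root subspace of `A` at `z`: the union of the kernels of the powers of `A - z I` (an
increasing sequence). -/
def rootSubspace (A : E →ₗ.[ℂ] E) (z : ℂ) : Submodule ℂ E := ⨆ n, kerPow A z n

/-- The algebraic multiplicity of `z`: the dimension of the root subspace (`⊤` if infinite). -/
def algMultiplicity (A : E →ₗ.[ℂ] E) (z : ℂ) : ℕ∞ :=
  Cardinal.toENat (Module.rank ℂ (rootSubspace A z))

theorem mem_kerPow_succ (A : E →ₗ.[ℂ] E) (z : ℂ) (n : ℕ) (y : E) :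
    y ∈ kerPow A z (n + 1) ↔ ∃ h : y ∈ A.domain, A ⟨y, h⟩ - z • y ∈ kerPow A z n := by
  simp [kerPow]

end Spectral

/-! ### The operator `-i d/dx` on a segment with a boundary condition -/

/-- The Hilbert space `L₂(0, b)`. -/
abbrev L2 (b : ℝ) : Type := Lp ℂ 2 (volume.restrict (Set.Ioo 0 b))

/-- `y` belongs to the Sobolev space `W₂¹[0, b]`, `u` is an absolutely continuous representative
of `y` and `g ∈ L₂(0, b)` is the derivative of `y`. -/
structure IsSobolev {b : ℝ} (y : L2 b) (u : ℝ → ℂ) (g : L2 b) : Prop where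
  absCont : AbsolutelyContinuousOnInterval u 0 b
  ae_eq : ∀ᵐ x ∂(volume.restrict (Set.Ioo 0 b)), y x = u x
  deriv : ∀ᵐ x ∂(volume.restrict (Set.Ioo 0 b)), HasDerivAt u (g x) x

/-- The integral `∫₀ᵇ f(x) conj(σ(x)) dx`. -/
def pairing {b : ℝ} (σ f : L2 b) : ℂ := ∫ x in Set.Ioo 0 b, f x * conj (σ x)

theorem pairing_eq_inner {b : ℝ} (σ f : L2 b) : pairing σ f = inner ℂ σ f := by
  rw [L2.inner_def]
  rfl

/-- The graph of `L`: the pairs `(y, -i y')` with `y ∈ W₂¹[0, b]` and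
`y(0) - ∫₀ᵇ (-i y'(x)) conj(σ(x)) dx = 0`. -/
def graph {b : ℝ} (σ : L2 b) : Submodule ℂ (L2 b × L2 b) where
  carrier := {p | ∃ (u : ℝ → ℂ) (g : L2 b), IsSobolev p.1 u g ∧ p.2 = (-Complex.I) • g ∧
    u 0 - pairing σ ((-Complex.I) • g) = 0}
  zero_mem' := by
    refine ⟨0, 0, ⟨?_, ?_, ?_⟩, by simp, by simp [pairing_eq_inner]⟩
    · exact (contDiff_const (c := (0 : ℂ))).contDiffOn.absolutelyContinuousOnInterval
    · filter_upwards [Lp.coeFn_zero ℂ 2 (volume.restrict (Set.Ioo 0 b))] with x hx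
      simpa using hx
    · filter_upwards [Lp.coeFn_zero ℂ 2 (volume.restrict (Set.Ioo 0 b))] with x hx
      rw [hx]
      exact hasDerivAt_const x (0 : ℂ)
  add_mem' := by
    rintro p q ⟨u, g, ⟨hu, hyu, hg⟩, hp, hU⟩ ⟨v, k, ⟨hv, hzv, hk⟩, hq, hV⟩
    refine ⟨u + v, g + k, ⟨hu.add hv, ?_, ?_⟩, by simp [hp, hq], ?_⟩
    · filter_upwards [hyu, hzv, Lp.coeFn_add p.1 q.1] with x h1 h2 h3
      rw [Prod.fst_add, h3, Pi.add_apply, h1, h2]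
      rfl
    · filter_upwards [hg, hk, Lp.coeFn_add g k] with x h1 h2 h3
      rw [h3]
      exact h1.add h2
    · rw [pairing_eq_inner] at *
      rw [smul_add, inner_add_right, Pi.add_apply]
      linear_combination hU + hV
  smul_mem' := by
    rintro c p ⟨u, g, ⟨hu, hyu, hg⟩, hp, hU⟩
    refine ⟨c • u, c • g, ⟨hu.const_smul c, ?_, ?_⟩, by simp [hp, smul_comm c], ?_⟩
    · filter_upwards [hyu, Lp.coeFn_smul c p.1] with x h1 h2
      simp [h1, h2]
    · filter_upwards [hg, Lp.coeFn_smul c g] with x h1 h2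
      rw [h2]
      exact h1.const_smul c
    · rw [pairing_eq_inner] at *
      rw [smul_comm, inner_smul_right, Pi.smul_apply, smul_eq_mul]
      linear_combination c * hU

/-- The derivative of a Sobolev function is determined by the function. -/
theorem graph_functional {b : ℝ} (σ : L2 b) (p : L2 b × L2 b) (hp : p ∈ graph σ)
    (h0 : p.1 = 0) : p.2 = 0 := by
  obtain ⟨u, g, ⟨hu, hyu, hg⟩, h2, -⟩ := hp
  rw [h2]
  suffices g = 0 by simp [this]
  have hu0 : ∀ᵐ x ∂(volume.restrict (Set.Ioo 0 b)), u x = 0 := by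
    filter_upwards [hyu, Lp.coeFn_zero ℂ 2 (volume.restrict (Set.Ioo 0 b))] with x h1 h3
    rw [← h1, h0, h3]
    rfl
  have hcont : ContinuousOn u (Set.Ioo 0 b) := hu.continuousOn.mono fun x hx =>
    Set.Ioo_subset_Icc_self.trans Set.Icc_subset_uIcc hx
  have hEq : Set.EqOn u 0 (Set.Ioo 0 b) :=
    Measure.eqOn_open_of_ae_eq hu0 isOpen_Ioo hcont continuousOn_const
  rw [Lp.eq_zero_iff_ae_eq_zero]
  filter_upwards [hg, ae_restrict_mem measurableSet_Ioo] with x h1 hx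
  have h3 : HasDerivAt u 0 x := (hasDerivAt_const x (0 : ℂ)).congr_of_eventuallyEq
    (Filter.eventually_of_mem (isOpen_Ioo.mem_nhds hx) hEq)
  exact h1.unique h3

/-- The operator `L y = -i y'` in `L₂(0, b)` with domain
`D(L) = {y ∈ W₂¹[0, b] : y(0) - ∫₀ᵇ (-i y'(x)) conj(σ(x)) dx = 0}`. -/
def L {b : ℝ} (σ : L2 b) : L2 b →ₗ.[ℂ] L2 b := (graph σ).toLinearPMap

theorem L_graph {b : ℝ} (σ : L2 b) : (L σ).graph = graph σ :=
  Submodule.toLinearPMap_graph_eq _ (graph_functional σ)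

/-- `Δ(z) = 1 - z ∫₀ᵇ exp(i z x) conj(σ(x)) dx`. -/
def Delta {b : ℝ} (σ : L2 b) (z : ℂ) : ℂ :=
  1 - z * ∫ x in Set.Ioo 0 b, Complex.exp (Complex.I * z * x) * conj (σ x)

end SegmentOperator

end

/-! Everything happens on the functions `p(x) exp(i z x)` with `p` a polynomial. There `-i d/dx - z`
acts as `p ↦ -i p'`, and solving `-i y' - z y = q exp(i z x)` stays in the class, so root vectors at
`z` are of this form and only the boundary condition must be tracked.

Let `B_z(p)` be the boundary functional at `p exp(i z x)`. Then `B_z(1) = Δ(z)`, and since `d/dz`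
multiplies `exp(i z x)` by `i x`, `Δ⁽ᵏ⁾(z) = iᵏ B_z(xᵏ)` (`iteratedDeriv_Delta`). So `Δ` vanishes to
order `m` at `z` iff `B_z(xᵏ) = 0` for `k < m` and `B_z(xᵐ) ≠ 0`. In that case the root subspace is
exactly the image of the polynomials of degree `< m` (`rootSubspace_eq_map_degreeLT`), of dimension
`m`. The order is finite because `Δ(0) = 1`.

For the spectrum: if `Δ(z) = 0`, then `exp(i z x)` is an eigenfunction. If not, a bounded Volterra
operator solves the equation with `y(0) = 0`, and adding a multiple of `exp(i z x)`, found by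
dividing by `Δ(z)`, restores the boundary condition (`exists_resolvent`). -/

namespace SegmentOperator

open Polynomial

/-! ### Exponential polynomials and the first-order equation they solve. -/

section ExponentialPolynomials

variable {b : ℝ}

/-- A continuous function is square integrable on a bounded interval. -/
theorem memLp_two_of_continuous (b : ℝ) {u : ℝ → ℂ} (hu : Continuous u) :
    MemLp u 2 (volume.restrict (Set.Ioo 0 b)) := by
  obtain ⟨C, hC⟩ := (isCompact_Icc (a := (0 : ℝ)) (b := b)).exists_bound_of_continuousOn
    hu.continuousOn
  refine MemLp.of_bound hu.aestronglyMeasurable C ?_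
  filter_upwards [ae_restrict_mem measurableSet_Ioo] with x hx
  exact hC x (Set.Ioo_subset_Icc_self hx)

/-- The function `x ↦ p(x) exp(i z x)`. -/
noncomputable def expPolyFun (z : ℂ) (p : ℂ[X]) (x : ℝ) : ℂ :=
  p.eval (x : ℂ) * Complex.exp (Complex.I * z * x)

theorem continuous_expPolyFun (z : ℂ) (p : ℂ[X]) : Continuous (expPolyFun z p) := by
  unfold expPolyFun
  have := p.continuous
  fun_prop

theorem hasDerivAt_exp_mul_ofReal (a : ℂ) (x : ℝ) :
    HasDerivAt (fun x : ℝ => Complex.exp (a * x)) (a * Complex.exp (a * x)) x := by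
  have h := ((hasDerivAt_id (x : ℂ)).const_mul a).cexp.comp_ofReal
  simpa [mul_comm] using h

theorem hasDerivAt_expPolyFun (z : ℂ) (p : ℂ[X]) (x : ℝ) :
    HasDerivAt (expPolyFun z p) (expPolyFun z (derivative p + C (Complex.I * z) * p) x) x := by
  have h := (p.hasDerivAt (x : ℂ)).comp_ofReal.mul (hasDerivAt_exp_mul_ofReal (Complex.I * z) x)
  refine h.congr_deriv ?_
  simp [expPolyFun]
  ring

/-- The class in `L₂(0, b)` of the function `p(x) exp(i z x)`, as a linear map in `p`. -/
noncomputable def expPoly (b : ℝ) (z : ℂ) : ℂ[X] →ₗ[ℂ] L2 b where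
  toFun p := (memLp_two_of_continuous b (continuous_expPolyFun z p)).toLp _
  map_add' p q := by
    rw [← MemLp.toLp_add]
    congr 1
    ext x
    simp [expPolyFun, add_mul]
  map_smul' c p := by
    rw [RingHom.id_apply, ← MemLp.toLp_const_smul]
    congr 1
    ext x
    simp [expPolyFun, mul_assoc]

theorem coeFn_expPoly (b : ℝ) (z : ℂ) (p : ℂ[X]) :
    expPoly b z p =ᵐ[volume.restrict (Set.Ioo 0 b)] expPolyFun z p :=
  MemLp.coeFn_toLp (memLp_two_of_continuous b (continuous_expPolyFun z p))

/-- The closed interval matters: the boundary condition reads off the value at the endpoint `0`. -/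
theorem eqOn_Icc_of_ae_eq {u v : ℝ → ℂ} (hu : ContinuousOn u (Set.uIcc 0 b))
    (hv : ContinuousOn v (Set.uIcc 0 b)) (hb : 0 < b)
    (h : u =ᵐ[volume.restrict (Set.Ioo 0 b)] v) : Set.EqOn u v (Set.Icc 0 b) := by
  rw [Set.uIcc_of_le hb.le] at hu hv
  have h1 : Set.EqOn u v (Set.Ioo 0 b) := Measure.eqOn_open_of_ae_eq h isOpen_Ioo
    (hu.mono Set.Ioo_subset_Icc_self) (hv.mono Set.Ioo_subset_Icc_self)
  exact h1.of_subset_closure hu hv Set.Ioo_subset_Icc_self (by rw [closure_Ioo hb.ne])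

theorem expPoly_injective (hb : 0 < b) (z : ℂ) : Function.Injective (expPoly b z) := by
  rw [injective_iff_map_eq_zero]
  intro p hp
  have h1 : expPolyFun z p =ᵐ[volume.restrict (Set.Ioo 0 b)] fun _ => 0 := by
    filter_upwards [coeFn_expPoly b z p, Lp.coeFn_zero ℂ 2 (volume.restrict (Set.Ioo 0 b))]
      with x h2 h3
    rw [← h2, hp, h3, Pi.zero_apply]
  have h2 := eqOn_Icc_of_ae_eq (continuous_expPolyFun z p).continuousOn
    continuousOn_const hb h1
  refine p.eq_zero_of_infinite_isRoot
    (((Set.Icc_infinite hb).image Complex.ofReal_injective.injOn).mono ?_)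
  rintro _ ⟨x, hx, rfl⟩
  simpa [expPolyFun, IsRoot] using h2 hx

theorem isSobolev_expPoly (b : ℝ) (z : ℂ) (p : ℂ[X]) :
    IsSobolev (expPoly b z p) (expPolyFun z p)
      (expPoly b z (derivative p + C (Complex.I * z) * p)) where
  absCont := by
    refine ContDiff.contDiffOn ?_ |>.absolutelyContinuousOnInterval
    rw [contDiff_one_iff_hasFDerivAt]
    refine ⟨fun x => ContinuousLinearMap.toSpanSingleton ℝ
      (expPolyFun z (derivative p + C (Complex.I * z) * p) x), ?_, fun x =>
      (hasDerivAt_expPolyFun z p x).hasFDerivAt⟩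
    exact (ContinuousLinearMap.toSpanSingletonCLE).continuous.comp (continuous_expPolyFun z _)
  ae_eq := coeFn_expPoly b z p
  deriv := by
    filter_upwards [coeFn_expPoly b z (derivative p + C (Complex.I * z) * p)] with x hx
    rw [hx]
    exact hasDerivAt_expPolyFun z p x

theorem IsSobolev.eqOn (hb : 0 < b) {y g k : L2 b} {u v : ℝ → ℂ} (hu : IsSobolev y u g)
    (hv : IsSobolev y v k) : Set.EqOn u v (Set.Icc 0 b) := by
  refine eqOn_Icc_of_ae_eq hu.absCont.continuousOn hv.absCont.continuousOn hb ?_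
  filter_upwards [hu.ae_eq, hv.ae_eq] with x h1 h2
  rw [← h1, h2]

theorem IsSobolev.deriv_unique (hb : 0 < b) {y g k : L2 b} {u v : ℝ → ℂ} (hu : IsSobolev y u g)
    (hv : IsSobolev y v k) : g = k := by
  refine Lp.ext ?_
  filter_upwards [hu.deriv, hv.deriv, ae_restrict_mem measurableSet_Ioo] with x h1 h2 hx
  exact h1.unique <| h2.congr_of_eventuallyEq <| Filter.eventually_of_mem
    (isOpen_Ioo.mem_nhds hx) fun t ht => hu.eqOn hb hv (Set.Ioo_subset_Icc_self ht)

/-- Solutions of `-i y' - z y = q(x) exp(i z x)` for a polynomial `q` are of the form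
`p(x) exp(i z x)`. -/
theorem IsSobolev.eq_expPoly (hb : 0 < b) {z : ℂ} {y g : L2 b} {u : ℝ → ℂ} {p : ℂ[X]}
    (hu : IsSobolev y u g)
    (h : (-Complex.I) • g - z • y = expPoly b z (-C Complex.I * derivative p)) :
    ∃ c, y = expPoly b z (p + C c) := by
  -- Integrating factor: `exp(-i z x) u - p` is absolutely continuous with zero derivative almost
  -- everywhere, hence constant.
  set e : ℝ → ℂ := fun x => Complex.exp (-(Complex.I * z) * x)
  have hsob := isSobolev_expPoly b (-z) 1
  have hone : expPolyFun (-z) 1 = e := by ext x; simp [expPolyFun, e]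
  have hsob0 := isSobolev_expPoly b 0 p
  have hzero : expPolyFun 0 p = fun x : ℝ => p.eval (x : ℂ) := by ext x; simp [expPolyFun]
  have hac : AbsolutelyContinuousOnInterval (e • u - fun x : ℝ => p.eval (x : ℂ)) 0 b := by
    rw [← hone, ← hzero]
    exact (hsob.absCont.smul hu.absCont).sub hsob0.absCont
  have hder : ∀ᵐ x : ℝ, x ∈ Set.uIcc 0 b →
      HasDerivAt (e • u - fun x : ℝ => p.eval (x : ℂ)) 0 x := by
    have h1 : ∀ᵐ x ∂(volume.restrict (Set.Ioo 0 b)),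
        HasDerivAt (e • u - fun x : ℝ => p.eval (x : ℂ)) 0 x := by
      filter_upwards [hu.deriv, hu.ae_eq, coeFn_expPoly b z (-C Complex.I * derivative p),
        Lp.coeFn_sub ((-Complex.I) • g) (z • y), Lp.coeFn_smul (-Complex.I) g,
        Lp.coeFn_smul z y] with x h1 h2 h3 h4 h5 h6
      rw [← h, h4, Pi.sub_apply, h5, h6, Pi.smul_apply, Pi.smul_apply, h2] at h3
      have h7 := ((hasDerivAt_exp_mul_ofReal (-(Complex.I * z)) x).mul h1).sub
        (p.hasDerivAt (x : ℂ)).comp_ofReal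
      refine h7.congr_deriv ?_
      have h8 : g x = Complex.I * (z * u x) +
          (derivative p).eval (x : ℂ) * Complex.exp (Complex.I * z * x) := by
        simp only [smul_eq_mul, expPolyFun, eval_mul, eval_neg, eval_C] at h3
        linear_combination Complex.I * h3 + (g x - (derivative p).eval (x : ℂ) *
          Complex.exp (Complex.I * z * x)) * Complex.I_mul_I
      have h9 : Complex.exp (-(Complex.I * z) * x) * Complex.exp (Complex.I * z * x) = 1 := by
        rw [← Complex.exp_add]
        simp
      rw [h8]
      linear_combination (derivative p).eval (x : ℂ) * h9
    rw [Measure.restrict_congr_set Ioo_ae_eq_Icc, ae_restrict_iff' measurableSet_Icc] at h1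
    rwa [Set.uIcc_of_le hb.le]
  obtain ⟨c, hc⟩ := hac.const_of_ae_hasDerivAt_zero hder
  refine ⟨c, Lp.ext ?_⟩
  filter_upwards [hu.ae_eq, coeFn_expPoly b z (p + C c), ae_restrict_mem measurableSet_Ioo]
    with x h1 h2 hx
  have h3 := hc x (by rw [Set.uIcc_of_le hb.le]; exact Set.Ioo_subset_Icc_self hx)
  simp only [Pi.sub_apply, smul_eq_mul, Pi.mul_apply, e] at h3
  have h9 : Complex.exp (-(Complex.I * z) * x) * Complex.exp (Complex.I * z * x) = 1 := by
    rw [← Complex.exp_add]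
    simp
  rw [h1, h2, expPolyFun, eval_add, eval_C]
  linear_combination Complex.exp (Complex.I * z * x) * h3 - u x * h9

end ExponentialPolynomials

/-! ### Root subspaces as spaces of polynomials. -/

section RootSubspace

variable {b : ℝ}

/-- The boundary functional `y(0) - ∫₀ᵇ (-i y') conj(σ)` evaluated at `y = p(x) exp(i z x)`. -/
noncomputable def boundary (σ : L2 b) (z : ℂ) : ℂ[X] →ₗ[ℂ] ℂ where
  toFun p := p.eval 0 - inner ℂ σ (expPoly b z (C z * p - C Complex.I * derivative p))
  map_add' p q := by
    rw [derivative_add, mul_add, mul_add, add_sub_add_comm, map_add, inner_add_right, eval_add]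
    ring
  map_smul' c p := by
    rw [derivative_smul, mul_smul_comm, mul_smul_comm, ← smul_sub, map_smul, inner_smul_right,
      eval_smul, RingHom.id_apply, smul_eq_mul, smul_eq_mul]
    ring

theorem boundary_apply (σ : L2 b) (z : ℂ) (p : ℂ[X]) : boundary σ z p =
    p.eval 0 - inner ℂ σ (expPoly b z (C z * p - C Complex.I * derivative p)) := rfl

theorem neg_I_smul_expPoly_deriv (b : ℝ) (z : ℂ) (p : ℂ[X]) :
    (-Complex.I) • expPoly b z (derivative p + C (Complex.I * z) * p) =
      expPoly b z (C z * p - C Complex.I * derivative p) := by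
  rw [← map_smul, smul_eq_C_mul]
  congr 1
  have h : (C Complex.I * C Complex.I : ℂ[X]) = -1 := by rw [← C_mul]; simp
  rw [C_mul, C_neg]
  linear_combination (-C z * p) * h

theorem expPoly_mem_graph (σ : L2 b) (z : ℂ) (p : ℂ[X]) (h : boundary σ z p = 0) :
    (expPoly b z p, expPoly b z (C z * p - C Complex.I * derivative p)) ∈ graph σ := by
  refine ⟨_, _, isSobolev_expPoly b z p, (neg_I_smul_expPoly_deriv b z p).symm, ?_⟩
  rw [neg_I_smul_expPoly_deriv, pairing_eq_inner, ← h, boundary_apply]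
  simp [expPolyFun]

/-- The graph only provides some representative and some derivative; uniqueness of both identifies
them with the explicit ones. -/
theorem boundary_eq_zero_of_mem_graph (hb : 0 < b) {σ : L2 b} {z : ℂ} {p : ℂ[X]} {f : L2 b}
    (h : (expPoly b z p, f) ∈ graph σ) : boundary σ z p = 0 := by
  obtain ⟨u, g, hu, -, h0⟩ := h
  have hs := isSobolev_expPoly b z p
  rw [hu.eqOn hb hs ⟨le_rfl, hb.le⟩, hu.deriv_unique hb hs, neg_I_smul_expPoly_deriv,
    pairing_eq_inner] at h0
  rw [boundary_apply]
  refine Eq.trans ?_ h0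
  simp [expPolyFun]

theorem mem_kerPow_succ_iff_graph (σ : L2 b) (z : ℂ) (n : ℕ) (y : L2 b) :
    y ∈ kerPow (L σ) z (n + 1) ↔ ∃ f, (y, f) ∈ graph σ ∧ f - z • y ∈ kerPow (L σ) z n := by
  rw [mem_kerPow_succ, ← L_graph]
  constructor
  · rintro ⟨h, h'⟩
    exact ⟨_, (L σ).mem_graph ⟨y, h⟩, h'⟩
  · rintro ⟨f, hf, h'⟩
    have hy := LinearPMap.mem_domain_of_mem_graph hf
    rw [(LinearPMap.image_iff hy).2 hf] at h'
    exact ⟨hy, h'⟩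

theorem expPoly_graph_sub (b : ℝ) (z : ℂ) (p : ℂ[X]) :
    expPoly b z (C z * p - C Complex.I * derivative p) - z • expPoly b z p =
      expPoly b z (-C Complex.I * derivative p) := by
  rw [← map_smul, ← map_sub, smul_eq_C_mul]
  congr 1
  ring

theorem boundary_eq_zero_of_mem_degreeLT {σ : L2 b} {z : ℂ} {n : ℕ}
    (h : ∀ k < n, boundary σ z (X ^ k) = 0) {p : ℂ[X]} (hp : p ∈ degreeLT ℂ n) :
    boundary σ z p = 0 := by
  have : degreeLT ℂ n ≤ LinearMap.ker (boundary σ z) := by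
    rw [degreeLT_eq_span_X_pow, Submodule.span_le]
    intro q hq
    obtain ⟨k, hk, rfl⟩ := by simpa using hq
    exact h k hk
  exact this hp

theorem C_mul_derivative_mem_degreeLT {p : ℂ[X]} {n : ℕ} (c : ℂ) (hp : p ∈ degreeLT ℂ (n + 1)) :
    C c * derivative p ∈ degreeLT ℂ n := by
  rw [← smul_eq_C_mul]
  refine Submodule.smul_mem _ _ ?_
  rw [mem_degreeLT, degree_lt_iff_coeff_zero] at hp ⊢
  intro k hk
  rw [coeff_derivative, hp (k + 1) (by lia), zero_mul]

/-- Every polynomial of degree `< n` is a multiple of a derivative of a polynomial of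
degree `< n + 1`. -/
theorem exists_C_mul_derivative_eq {c : ℂ} (hc : c ≠ 0) {q : ℂ[X]} {n : ℕ}
    (hq : q ∈ degreeLT ℂ n) : ∃ p ∈ degreeLT ℂ (n + 1), C c * derivative p = q := by
  have : degreeLT ℂ n ≤ (degreeLT ℂ (n + 1)).map (c • derivative) := by
    rw [degreeLT_eq_span_X_pow (n := n), Submodule.span_le]
    intro r hr
    obtain ⟨k, hk, rfl⟩ := by simpa using hr
    refine ⟨(c⁻¹ * ((k : ℂ) + 1)⁻¹) • X ^ (k + 1), Submodule.smul_mem _ _ ?_, ?_⟩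
    · rw [mem_degreeLT, degree_X_pow]
      exact_mod_cast Nat.succ_lt_succ hk
    · have hk : ((k : ℂ) + 1) ≠ 0 := by exact_mod_cast k.succ_ne_zero
      have h1 : c * (c⁻¹ * ((k : ℂ) + 1)⁻¹) * ((k : ℂ) + 1) = 1 := by field_simp
      rw [LinearMap.smul_apply, map_smul, smul_smul, derivative_X_pow, ← smul_eq_C_mul, smul_smul,
        Nat.cast_add, Nat.cast_one, h1, one_smul, Nat.add_sub_cancel]
  obtain ⟨p, hp, h⟩ := this hq
  exact ⟨p, hp, by rw [← h, LinearMap.smul_apply, smul_eq_C_mul]⟩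

/-- `L - z` differentiates the polynomial, so each application lowers the degree while staying among
polynomials that satisfy the boundary condition. -/
theorem expPoly_mem_kerPow {σ : L2 b} {z : ℂ} {n : ℕ}
    (h : ∀ k < n, boundary σ z (X ^ k) = 0) {p : ℂ[X]} (hp : p ∈ degreeLT ℂ n) :
    expPoly b z p ∈ kerPow (L σ) z n := by
  induction n generalizing p with
  | zero =>
    have : p = 0 := by simpa [mem_degreeLT] using hp
    rw [this, map_zero]
    exact Submodule.zero_mem _
  | succ n ih =>
    rw [mem_kerPow_succ_iff_graph]
    refine ⟨_, expPoly_mem_graph σ z p (boundary_eq_zero_of_mem_degreeLT h hp), ?_⟩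
    rw [expPoly_graph_sub, ← C_neg]
    exact ih (fun k hk => h k (by lia)) (C_mul_derivative_mem_degreeLT _ hp)

/-- The bound on the degree does not depend on `n`: inverting `L - z` once could raise the degree to
`m`, but `B_z(xᵐ) ≠ 0` forbids a term in `xᵐ`. -/
theorem kerPow_le_map_degreeLT (hb : 0 < b) {σ : L2 b} {z : ℂ} {m : ℕ}
    (h : ∀ k < m, boundary σ z (X ^ k) = 0) (hm : boundary σ z (X ^ m) ≠ 0) (n : ℕ) :
    kerPow (L σ) z n ≤ (degreeLT ℂ m).map (expPoly b z) := by
  induction n with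
  | zero => exact bot_le
  | succ n ih =>
    intro y hy
    rw [mem_kerPow_succ_iff_graph] at hy
    obtain ⟨f, hf, hfy⟩ := hy
    obtain ⟨q, hq, hqy⟩ := ih hfy
    obtain ⟨p, hp, rfl⟩ := exists_C_mul_derivative_eq (neg_ne_zero.2 Complex.I_ne_zero) hq
    obtain ⟨u, g, hu, hfg, -⟩ := id hf
    rw [show f = _ from hfg, C_neg] at hqy
    obtain ⟨c, rfl⟩ := hu.eq_expPoly hb hqy.symm
    refine ⟨p + C c, ?_, rfl⟩
    have hr : p + C c ∈ degreeLT ℂ (m + 1) := by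
      refine Submodule.add_mem _ hp ?_
      rw [mem_degreeLT]
      exact degree_C_le.trans_lt (by exact_mod_cast m.succ_pos)
    have h0 := boundary_eq_zero_of_mem_graph hb hf
    generalize p + C c = r at hr h0
    -- Without its `xᵐ` term `r` is annihilated by the boundary functional, as is `r` itself; hence
    -- the coefficient of `xᵐ` is zero.
    have hs : r - r.coeff m • X ^ m ∈ degreeLT ℂ m := by
      rw [mem_degreeLT, degree_lt_iff_coeff_zero] at hr ⊢
      intro k hk
      rcases hk.eq_or_lt with rfl | hk
      · simp
      · simp [hr k hk, coeff_X_pow, hk.ne']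
    have h1 := boundary_eq_zero_of_mem_degreeLT h hs
    rw [map_sub, map_smul, h0, zero_sub, neg_eq_zero, smul_eq_zero, or_iff_left hm] at h1
    rwa [h1, zero_smul, sub_zero] at hs

theorem rootSubspace_eq_map_degreeLT (hb : 0 < b) {σ : L2 b} {z : ℂ} {m : ℕ}
    (h : ∀ k < m, boundary σ z (X ^ k) = 0) (hm : boundary σ z (X ^ m) ≠ 0) :
    rootSubspace (L σ) z = (degreeLT ℂ m).map (expPoly b z) := by
  refine le_antisymm (iSup_le (kerPow_le_map_degreeLT hb h hm)) ?_
  rintro _ ⟨p, hp, rfl⟩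
  exact Submodule.mem_iSup_of_mem m (expPoly_mem_kerPow h hp)

theorem algMultiplicity_eq (hb : 0 < b) {σ : L2 b} {z : ℂ} {m : ℕ}
    (h : ∀ k < m, boundary σ z (X ^ k) = 0) (hm : boundary σ z (X ^ m) ≠ 0) :
    algMultiplicity (L σ) z = m := by
  rw [algMultiplicity, rootSubspace_eq_map_degreeLT hb h hm,
    ← ((Submodule.equivMapOfInjective _ (expPoly_injective hb z) _).symm.trans
      (degreeLTEquiv ℂ m)).symm.rank_eq]
  simp

end RootSubspace

/-! ### Derivatives of `Δ` as boundary values. -/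

section CharacteristicFunction

variable {b : ℝ}

/-- `∫₀ᵇ xᵏ exp(i z x) conj(σ(x)) dx`. -/
noncomputable def moment (σ : L2 b) (k : ℕ) (z : ℂ) : ℂ := inner ℂ σ (expPoly b z (X ^ k))

theorem moment_eq_integral (σ : L2 b) (k : ℕ) (z : ℂ) : moment σ k z =
    ∫ x in Set.Ioo 0 b, (x : ℂ) ^ k * Complex.exp (Complex.I * z * x) * conj (σ x) := by
  rw [moment, ← pairing_eq_inner, pairing]
  refine integral_congr_ae ?_
  filter_upwards [coeFn_expPoly b z (X ^ k)] with x hx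
  simp [hx, expPolyFun]

theorem integrable_continuous_mul_conj (σ : L2 b) {u : ℝ → ℂ} (hu : Continuous u) :
    Integrable (fun x => u x * conj (σ x)) (volume.restrict (Set.Ioo 0 b)) := by
  have hσ : MemLp (fun x => conj (σ x)) 2 (volume.restrict (Set.Ioo 0 b)) := (Lp.memLp σ).star
  exact (memLp_two_of_continuous b hu).integrable_mul hσ

theorem hasDerivAt_moment (σ : L2 b) (k : ℕ) (z : ℂ) :
    HasDerivAt (moment σ k) (Complex.I * moment σ (k + 1) z) z := by
  have hcont (j : ℕ) (w : ℂ) :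
      Continuous fun x : ℝ => (x : ℂ) ^ j * Complex.exp (Complex.I * w * x) := by fun_prop
  have key := (hasDerivAt_integral_of_dominated_loc_of_deriv_le (𝕜 := ℂ)
    (μ := volume.restrict (Set.Ioo 0 b)) (x₀ := z) (s := Metric.ball z 1)
    (F := fun w x => (x : ℂ) ^ k * Complex.exp (Complex.I * w * x) * conj (σ x))
    (F' := fun w x => Complex.I * ((x : ℂ) ^ (k + 1) * Complex.exp (Complex.I * w * x) *
      conj (σ x)))
    -- For `w` in the unit ball around `z`, `|exp(i w x)| ≤ exp((‖z‖ + 1)|x|)`.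
    (bound := fun x => ‖((|x| ^ (k + 1) * Real.exp ((‖z‖ + 1) * |x|) : ℝ) : ℂ) * conj (σ x)‖)
    (Metric.ball_mem_nhds z one_pos)
    (.of_forall fun w => (integrable_continuous_mul_conj σ (hcont k w)).aestronglyMeasurable)
    (integrable_continuous_mul_conj σ (hcont k z))
    ((integrable_continuous_mul_conj σ (hcont (k + 1) z)).const_mul _).aestronglyMeasurable
    (.of_forall fun x w hw => ?_)
    (integrable_continuous_mul_conj σ (by fun_prop)).norm
    (.of_forall fun x w _ => ?_)).2
  · rw [integral_const_mul, ← moment_eq_integral] at key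
    exact key.congr_of_eventuallyEq (.of_forall fun w => moment_eq_integral σ k w)
  · rw [norm_mul, norm_mul, norm_mul, norm_mul, Complex.norm_I, one_mul, norm_pow,
      Complex.norm_real, Complex.norm_real, Real.norm_eq_abs, Real.norm_of_nonneg (by positivity)]
    gcongr
    refine (Complex.norm_exp_le_exp_norm _).trans ?_
    rw [norm_mul, norm_mul, Complex.norm_I, one_mul, Complex.norm_real, Real.norm_eq_abs]
    gcongr
    rw [mem_ball_iff_norm] at hw
    linarith [norm_le_norm_add_norm_sub' w z]
  · have h := (((hasDerivAt_id w).const_mul Complex.I).mul_const (x : ℂ)).cexp.const_mul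
      ((x : ℂ) ^ k) |>.mul_const (conj (σ x))
    refine h.congr_deriv ?_
    simp
    ring

theorem boundary_X_pow_zero (σ : L2 b) (z : ℂ) : boundary σ z (X ^ 0) = 1 - z * moment σ 0 z := by
  rw [boundary_apply, moment, pow_zero, derivative_one, mul_zero, sub_zero, ← smul_eq_C_mul,
    map_smul, inner_smul_right, eval_one]

theorem boundary_X_pow_succ (σ : L2 b) (z : ℂ) (k : ℕ) : boundary σ z (X ^ (k + 1)) =
    Complex.I * (k + 1) * moment σ k z - z * moment σ (k + 1) z := by
  have : C z * X ^ (k + 1) - C Complex.I * derivative (X ^ (k + 1)) =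
      z • X ^ (k + 1) - (Complex.I * (k + 1)) • (X ^ k : ℂ[X]) := by
    rw [derivative_X_pow, smul_eq_C_mul, smul_eq_C_mul, C_mul, mul_assoc]
    simp
  rw [boundary_apply, this, map_sub, map_smul, map_smul, inner_sub_right, inner_smul_right,
    inner_smul_right, moment, moment]
  simp

theorem Delta_eq_boundary (σ : L2 b) (z : ℂ) : Delta σ z = boundary σ z (X ^ 0) := by
  rw [boundary_X_pow_zero, moment_eq_integral, Delta]
  simp

/-- The functional depends on `z` only through `exp(i z x)`, whose `z`-derivative is `i x exp(i z
x)`; this raises the power of `x` by one. -/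
theorem hasDerivAt_boundary_X_pow (σ : L2 b) (k : ℕ) (z : ℂ) :
    HasDerivAt (fun w => boundary σ w (X ^ k)) (Complex.I * boundary σ z (X ^ (k + 1))) z := by
  cases k with
  | zero =>
    simp_rw [boundary_X_pow_zero, zero_add]
    have h := ((hasDerivAt_id z).mul (hasDerivAt_moment σ 0 z)).const_sub 1
    refine h.congr_deriv ?_
    have := boundary_X_pow_succ σ z 0
    rw [zero_add] at this
    rw [this]
    simp only [id, Nat.cast_zero]
    linear_combination (-moment σ 0 z) * Complex.I_mul_I
  | succ k =>
    simp_rw [boundary_X_pow_succ σ _ k]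
    have h := ((hasDerivAt_moment σ k z).const_mul (Complex.I * (k + 1))).sub
      ((hasDerivAt_id z).mul (hasDerivAt_moment σ (k + 1) z))
    refine h.congr_deriv ?_
    rw [boundary_X_pow_succ]
    simp only [id, Nat.cast_add, Nat.cast_one]
    linear_combination (-moment σ (k + 1) z) * Complex.I_mul_I

theorem iteratedDeriv_Delta (σ : L2 b) (k : ℕ) :
    iteratedDeriv k (Delta σ) = fun z => Complex.I ^ k * boundary σ z (X ^ k) := by
  induction k with
  | zero => ext z; simp [Delta_eq_boundary]
  | succ k ih =>
    ext z
    rw [iteratedDeriv_succ, ih, ((hasDerivAt_boundary_X_pow σ k z).const_mul _).deriv]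
    ring

theorem differentiable_Delta (σ : L2 b) : Differentiable ℂ (Delta σ) := fun z =>
  ((hasDerivAt_boundary_X_pow σ 0 z).congr_of_eventuallyEq
    (.of_forall fun w => Delta_eq_boundary σ w)).differentiableAt

/-- `Δ(0) = 1`, and the identity theorem carries finite order to every point. -/
theorem analyticOrderAt_Delta_ne_top (σ : L2 b) (z : ℂ) : analyticOrderAt (Delta σ) z ≠ ⊤ := by
  have h : AnalyticOnNhd ℂ (Delta σ) Set.univ := fun w _ => (differentiable_Delta σ).analyticAt w
  refine h.analyticOrderAt_ne_top_of_isPreconnected isPreconnected_univ (Set.mem_univ 0)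
    (Set.mem_univ z) ?_
  rw [(h 0 trivial).analyticOrderAt_eq_zero.2 (by simp [Delta])]
  exact ENat.zero_ne_top

theorem algMultiplicity_eq_analyticOrderAt (hb : 0 < b) (σ : L2 b) (z : ℂ) :
    algMultiplicity (L σ) z = analyticOrderAt (Delta σ) z := by
  obtain ⟨m, hm⟩ := ENat.ne_top_iff_exists.1 (analyticOrderAt_Delta_ne_top σ z)
  have h := (analyticOrderAt_eq_nat_iff_iteratedDeriv_eq_zero
    ((differentiable_Delta σ).analyticAt z)).1 hm.symm
  simp only [iteratedDeriv_Delta, ne_eq, mul_eq_zero, pow_eq_zero_iff', Complex.I_ne_zero,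
    false_and, false_or] at h
  rw [← hm, algMultiplicity_eq hb h.1 h.2]

end CharacteristicFunction

/-! ### The resolvent off the zeros of `Δ`, and the spectrum. -/

section Resolvent

variable {b : ℝ}

/-- Reduction to the real and imaginary parts: increments are bounded by the sum of theirs. -/
theorem absolutelyContinuousOnInterval_integral {f : ℝ → ℂ} {a b : ℝ}
    (hf : IntervalIntegrable f volume a b) :
    AbsolutelyContinuousOnInterval (fun x => ∫ t in a..x, f t) a b := by
  have hre : IntervalIntegrable (fun t => (f t).re) volume a b := ⟨hf.1.re, hf.2.re⟩
  have him : IntervalIntegrable (fun t => (f t).im) volume a b := ⟨hf.1.im, hf.2.im⟩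
  have hre' := hre.absolutelyContinuousOnInterval_intervalIntegral Set.left_mem_uIcc
  have him' := him.absolutelyContinuousOnInterval_intervalIntegral Set.left_mem_uIcc
  have hsub {x : ℝ} (hx : x ∈ Set.uIcc a b) : IntervalIntegrable f volume a x :=
    hf.mono_set (Set.uIcc_subset_uIcc_left hx)
  refine squeeze_zero' (.of_forall fun t => Finset.sum_nonneg fun i _ => dist_nonneg) ?_
    (by simpa using Filter.Tendsto.add hre' him')
  filter_upwards [Filter.mem_inf_of_right (Filter.mem_principal_self _)] with E hE
  rw [← Finset.sum_add_distrib]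
  refine Finset.sum_le_sum fun i hi => ?_
  have h1 := hsub (hE.1 i hi).1
  have h2 := hsub (hE.1 i hi).2
  have hre_int {x : ℝ} (hx : IntervalIntegrable f volume a x) :
      ∫ t in a..x, (f t).re = (∫ t in a..x, f t).re :=
    Complex.reCLM.intervalIntegral_comp_comm hx
  have him_int {x : ℝ} (hx : IntervalIntegrable f volume a x) :
      ∫ t in a..x, (f t).im = (∫ t in a..x, f t).im :=
    Complex.imCLM.intervalIntegral_comp_comm hx
  rw [hre_int h1, hre_int h2, him_int h1, him_int h2, dist_eq_norm, Real.dist_eq, Real.dist_eq,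
    ← Complex.sub_re, ← Complex.sub_im]
  exact Complex.norm_le_abs_re_add_abs_im _

theorem integrableOn_exp_mul (z : ℂ) (f : L2 b) :
    IntegrableOn (fun t : ℝ => Complex.exp (-(Complex.I * z) * t) * f t) (Set.Ioo 0 b) :=
  (memLp_two_of_continuous b (by fun_prop)).integrable_mul (Lp.memLp f)

theorem intervalIntegrable_exp_mul (hb : 0 < b) (z : ℂ) (f : L2 b) : IntervalIntegrable
    (fun t : ℝ => Complex.exp (-(Complex.I * z) * t) * f t) volume 0 b := by
  rw [intervalIntegrable_iff_integrableOn_Ioo_of_le hb.le]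
  exact integrableOn_exp_mul z f

/-- The solution of `-i y' = z y + f`, `y(0) = 0`. -/
noncomputable def volterraFun (z : ℂ) (f : L2 b) (x : ℝ) : ℂ :=
  Complex.I * Complex.exp (Complex.I * z * x) *
    ∫ t in (0 : ℝ)..x, Complex.exp (-(Complex.I * z) * t) * f t

theorem absolutelyContinuous_volterraFun (hb : 0 < b) (z : ℂ) (f : L2 b) :
    AbsolutelyContinuousOnInterval (volterraFun z f) 0 b := by
  have h := ((isSobolev_expPoly b z 1).absCont.smul
    (absolutelyContinuousOnInterval_integral (intervalIntegrable_exp_mul hb z f))).const_smul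
    Complex.I
  refine (funext fun x => ?_ : _ = volterraFun z f) ▸ h
  simp [expPolyFun, volterraFun, mul_assoc]

theorem ae_hasDerivAt_volterraFun (hb : 0 < b) (z : ℂ) (f : L2 b) :
    ∀ᵐ x ∂(volume.restrict (Set.Ioo 0 b)),
      HasDerivAt (volterraFun z f) (Complex.I * (z * volterraFun z f x + f x)) x := by
  filter_upwards [ae_restrict_of_ae (intervalIntegrable_exp_mul hb z f).ae_hasDerivAt_integral,
    ae_restrict_mem measurableSet_Ioo] with x hx hxb
  have h1 := hx (by rw [Set.uIcc_of_le hb.le]; exact Set.Ioo_subset_Icc_self hxb) 0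
    Set.left_mem_uIcc
  have h2 := ((hasDerivAt_exp_mul_ofReal (Complex.I * z) x).const_mul Complex.I).mul h1
  refine h2.congr_deriv ?_
  have h9 : Complex.exp (Complex.I * z * x) * Complex.exp (-(Complex.I * z) * x) = 1 := by
    rw [← Complex.exp_add]
    simp
  rw [volterraFun]
  linear_combination Complex.I * f x * h9

/-- Hölder's inequality on a finite measure space. -/
theorem integral_norm_le_const_mul_norm (f : L2 b) :
    ∫ x in Set.Ioo 0 b, ‖f x‖ ≤
      ((volume.restrict (Set.Ioo 0 b) Set.univ) ^ (1 / 2 : ℝ)).toReal * ‖f‖ := by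
  rw [integral_norm_eq_lintegral_enorm (Lp.aestronglyMeasurable f), ← eLpNorm_one_eq_lintegral_enorm,
    Lp.norm_def, mul_comm, ← ENNReal.toReal_mul]
  refine ENNReal.toReal_mono (ENNReal.mul_ne_top (Lp.eLpNorm_ne_top f)
    (ENNReal.rpow_ne_top_of_nonneg (by norm_num) (measure_ne_top _ _))) ?_
  refine (eLpNorm_le_eLpNorm_mul_rpow_measure_univ (p := 1) (q := 2) (by norm_num)
    (Lp.aestronglyMeasurable f)).trans_eq ?_
  norm_num

/-- A sup bound uniform in `f` gives both square integrability and boundedness of the Volterra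
operator. -/
theorem exists_volterraFun_bound (hb : 0 < b) (z : ℂ) : ∃ C : ℝ, 0 ≤ C ∧
    ∀ (f : L2 b), ∀ x ∈ Set.Icc 0 b, ‖volterraFun z f x‖ ≤ C * ‖f‖ := by
  obtain ⟨A, hA⟩ := (isCompact_Icc (a := (0 : ℝ)) (b := b)).exists_bound_of_continuousOn
    (f := fun x : ℝ => Complex.exp (Complex.I * z * x)) (by fun_prop)
  obtain ⟨B, hB⟩ := (isCompact_Icc (a := (0 : ℝ)) (b := b)).exists_bound_of_continuousOn
    (f := fun x : ℝ => Complex.exp (-(Complex.I * z) * x)) (by fun_prop)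
  have hA0 : 0 ≤ A := (norm_nonneg _).trans (hA 0 ⟨le_rfl, hb.le⟩)
  have hB0 : 0 ≤ B := (norm_nonneg _).trans (hB 0 ⟨le_rfl, hb.le⟩)
  set D := ((volume.restrict (Set.Ioo 0 b) Set.univ) ^ (1 / 2 : ℝ)).toReal
  have hD : 0 ≤ D := ENNReal.toReal_nonneg
  refine ⟨A * (B * D), by positivity, fun f x hx => ?_⟩
  rw [volterraFun, norm_mul, norm_mul, Complex.norm_I, one_mul, mul_assoc A]
  refine mul_le_mul (hA x hx) ?_ (norm_nonneg _) hA0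
  have hint : IntegrableOn (fun t => ‖f t‖) (Set.Ioo 0 b) :=
    ((Lp.memLp f).integrable (by norm_num)).norm
  calc ‖∫ t in (0 : ℝ)..x, Complex.exp (-(Complex.I * z) * t) * f t‖
      ≤ ∫ t in Set.Ioo 0 x, ‖Complex.exp (-(Complex.I * z) * t) * f t‖ := by
        rw [intervalIntegral.integral_of_le hx.1, integral_Ioc_eq_integral_Ioo]
        exact norm_integral_le_integral_norm _
    _ ≤ ∫ t in Set.Ioo 0 b, ‖Complex.exp (-(Complex.I * z) * t) * f t‖ :=
        setIntegral_mono_set (integrableOn_exp_mul z f).norm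
          (.of_forall fun _ => norm_nonneg _) (Set.Ioo_subset_Ioo_right hx.2).eventuallyLE
    _ ≤ ∫ t in Set.Ioo 0 b, B * ‖f t‖ := by
        refine setIntegral_mono_on (integrableOn_exp_mul z f).norm (hint.const_mul B)
          measurableSet_Ioo fun t ht => ?_
        rw [norm_mul]
        gcongr
        exact hB t (Set.Ioo_subset_Icc_self ht)
    _ ≤ B * D * ‖f‖ := by
        rw [integral_const_mul, mul_assoc]
        gcongr
        exact integral_norm_le_const_mul_norm f

theorem memLp_volterraFun (hb : 0 < b) (z : ℂ) (f : L2 b) :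
    MemLp (volterraFun z f) 2 (volume.restrict (Set.Ioo 0 b)) := by
  obtain ⟨C, -, hC⟩ := exists_volterraFun_bound hb z
  refine MemLp.of_bound (((absolutelyContinuous_volterraFun hb z f).continuousOn.mono
    (Set.uIcc_of_le hb.le ▸ Set.Ioo_subset_Icc_self)).aestronglyMeasurable measurableSet_Ioo)
    (C * ‖f‖) ?_
  filter_upwards [ae_restrict_mem measurableSet_Ioo] with x hx
  exact hC f x (Set.Ioo_subset_Icc_self hx)

/-- There is a bounded operator solving `-i y' = z y + f`, `y(0) = 0`. -/
theorem exists_volterra (hb : 0 < b) (z : ℂ) :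
    ∃ V : L2 b →L[ℂ] L2 b, ∀ f, V f =ᵐ[volume.restrict (Set.Ioo 0 b)] volterraFun z f := by
  obtain ⟨C, hC0, hC⟩ := exists_volterraFun_bound hb z
  have hae (f : L2 b) : (memLp_volterraFun hb z f).toLp _ =ᵐ[volume.restrict (Set.Ioo 0 b)]
    volterraFun z f := MemLp.coeFn_toLp (memLp_volterraFun hb z f)
  have hint (f : L2 b) {x : ℝ} (hx : x ∈ Set.Ioo 0 b) : IntervalIntegrable
      (fun t : ℝ => Complex.exp (-(Complex.I * z) * t) * f t) volume 0 x := by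
    refine (intervalIntegrable_exp_mul hb z f).mono_set (Set.uIcc_subset_uIcc_left ?_)
    rw [Set.uIcc_of_le hb.le]
    exact Set.Ioo_subset_Icc_self hx
  -- Sums and multiples in `L₂` are pointwise only almost everywhere; the integral does not see the
  -- difference.
  have hcongr {F G : ℝ → ℂ} (h : F =ᵐ[volume.restrict (Set.Ioo 0 b)] G) {x : ℝ}
      (hx : x ∈ Set.Ioo 0 b) :
      ∫ t in (0 : ℝ)..x, Complex.exp (-(Complex.I * z) * t) * F t =
        ∫ t in (0 : ℝ)..x, Complex.exp (-(Complex.I * z) * t) * G t := by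
    rw [intervalIntegral.integral_of_le hx.1.le, intervalIntegral.integral_of_le hx.1.le]
    refine integral_congr_ae ?_
    filter_upwards [ae_restrict_of_ae_restrict_of_subset
      (fun t ht => ⟨ht.1, ht.2.trans_lt hx.2⟩ : Set.Ioc 0 x ⊆ Set.Ioo 0 b) h] with t ht
    rw [ht]
  let V₀ : L2 b →ₗ[ℂ] L2 b :=
    { toFun := fun f => (memLp_volterraFun hb z f).toLp _
      map_add' := fun f g => by
        refine Lp.ext ?_
        filter_upwards [hae (f + g), hae f, hae g, Lp.coeFn_add
          ((memLp_volterraFun hb z f).toLp _) ((memLp_volterraFun hb z g).toLp _),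
          ae_restrict_mem measurableSet_Ioo] with x h1 h2 h3 h4 hx
        rw [h1, h4, Pi.add_apply, h2, h3, volterraFun, hcongr (Lp.coeFn_add f g) hx]
        simp_rw [Pi.add_apply, mul_add]
        rw [intervalIntegral.integral_add (hint f hx) (hint g hx), mul_add]
        rfl
      map_smul' := fun c f => by
        refine Lp.ext ?_
        filter_upwards [hae (c • f), hae f, Lp.coeFn_smul c ((memLp_volterraFun hb z f).toLp _),
          ae_restrict_mem measurableSet_Ioo] with x h1 h2 h4 hx
        rw [h1, RingHom.id_apply, h4, Pi.smul_apply, h2, volterraFun,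
          hcongr (Lp.coeFn_smul c f) hx]
        simp_rw [Pi.smul_apply, smul_eq_mul, mul_left_comm _ c]
        rw [intervalIntegral.integral_const_mul, volterraFun]
        ring }
  refine ⟨V₀.mkContinuous
    -- The first factor, the square root of the measure of the interval, turns the sup bound into an
    -- `L₂` bound.
    (measureUnivNNReal (volume.restrict (Set.Ioo 0 b)) ^ (2 : ENNReal).toReal⁻¹ * C) fun f => ?_,
    hae⟩
  rw [mul_assoc]
  refine Lp.norm_le_of_ae_bound (by positivity) ?_
  filter_upwards [hae f, ae_restrict_mem measurableSet_Ioo] with x h1 hx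
  change ‖((memLp_volterraFun hb z f).toLp _ : ℝ → ℂ) x‖ ≤ _
  rw [h1]
  exact hC f x (Set.Ioo_subset_Icc_self hx)

theorem IsSobolev.add {y w g k : L2 b} {u v : ℝ → ℂ} (hu : IsSobolev y u g)
    (hv : IsSobolev w v k) : IsSobolev (y + w) (u + v) (g + k) where
  absCont := hu.absCont.add hv.absCont
  ae_eq := by
    filter_upwards [hu.ae_eq, hv.ae_eq, Lp.coeFn_add y w] with x h1 h2 h3
    rw [h3, Pi.add_apply, Pi.add_apply, h1, h2]
  deriv := by
    filter_upwards [hu.deriv, hv.deriv, Lp.coeFn_add g k] with x h1 h2 h3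
    rw [h3]
    exact h1.add h2

/-- Off the zeros of `Δ` the operator `L - z` is injective. -/
theorem eq_zero_of_mem_graph_smul (hb : 0 < b) {σ : L2 b} {z : ℂ} (hz : Delta σ z ≠ 0)
    {y : L2 b} (hy : (y, z • y) ∈ graph σ) : y = 0 := by
  obtain ⟨u, g, hu, hg, -⟩ := id hy
  obtain ⟨c, rfl⟩ := hu.eq_expPoly (p := 0) (z := z) hb (by
    rw [show z • y = _ from hg]; simp)
  have h := boundary_eq_zero_of_mem_graph hb hy
  have hc : (0 : ℂ[X]) + C c = c • X ^ 0 := by simp [smul_eq_C_mul]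
  rw [hc, map_smul, ← Delta_eq_boundary, smul_eq_zero, or_iff_left hz] at h
  rw [h, C_0, add_zero, map_zero]

theorem exists_resolvent (hb : 0 < b) {σ : L2 b} {z : ℂ} (hz : Delta σ z ≠ 0) :
    ∃ R : L2 b →L[ℂ] L2 b, ∀ f, (R f, z • R f + f) ∈ graph σ := by
  obtain ⟨V, hV⟩ := exists_volterra hb z
  let R : L2 b →L[ℂ] L2 b :=
    V + ((Delta σ z)⁻¹ • (innerSL ℂ σ ∘L (z • V + ContinuousLinearMap.id ℂ (L2 b)))).smulRight
      (expPoly b z (X ^ 0))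
  refine ⟨R, fun f => ?_⟩
  -- The boundary functional is `-⟨σ, z V f + f⟩` at `V f`, which vanishes at `0`, and `Δ(z)` at
  -- `exp(i z x)`; this `c` makes the total zero.
  set c : ℂ := (Delta σ z)⁻¹ * inner ℂ σ (z • V f + f) with hc
  have hRf : R f = V f + expPoly b z (c • X ^ 0) := by
    rw [map_smul]
    simp [R, hc, inner_add_right, inner_smul_right, mul_add]
  rw [hRf]
  have hVs : IsSobolev (V f) (volterraFun z f) (Complex.I • (z • V f + f)) := by
    refine ⟨absolutelyContinuous_volterraFun hb z f, hV f, ?_⟩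
    filter_upwards [hV f, ae_hasDerivAt_volterraFun hb z f, Lp.coeFn_add (z • V f) f,
      Lp.coeFn_smul z (V f), Lp.coeFn_smul Complex.I (z • V f + f)] with x h1 h2 h3 h4 h5
    rw [h5, Pi.smul_apply, h3, Pi.add_apply, h4, Pi.smul_apply, h1]
    exact h2
  have hs := hVs.add (isSobolev_expPoly b z (c • X ^ 0))
  have h2 : expPoly b z (C z * c • X ^ 0 - C Complex.I * derivative (c • X ^ 0)) =
      z • expPoly b z (c • X ^ 0) := by
    rw [← map_smul, smul_eq_C_mul]
    simp
  have hval : (-Complex.I) • (Complex.I • (z • V f + f) +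
      expPoly b z (derivative (c • X ^ 0) + C (Complex.I * z) * c • X ^ 0)) =
      (z • V f + f) + z • expPoly b z (c • X ^ 0) := by
    rw [smul_add, neg_I_smul_expPoly_deriv, smul_smul, h2, neg_mul, Complex.I_mul_I, neg_neg,
      one_smul]
  refine ⟨_, _, hs, ?_, ?_⟩
  · rw [hval, smul_add]
    module
  · have h1 : boundary σ z (c • X ^ 0) = inner ℂ σ (z • V f + f) := by
      rw [map_smul, ← Delta_eq_boundary, hc, smul_eq_mul]
      field_simp
    rw [boundary_apply, h2] at h1
    rw [hval, pairing_eq_inner, inner_add_right, ← h1]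
    simp [volterraFun, expPolyFun]

theorem mem_resolventSet_of_Delta_ne_zero (hb : 0 < b) {σ : L2 b} {z : ℂ} (hz : Delta σ z ≠ 0) :
    z ∈ resolventSet (L σ) := by
  obtain ⟨R, hR⟩ := exists_resolvent hb hz
  refine ⟨R, fun f => ?_, fun y => ?_⟩
  · have h := hR f
    rw [← L_graph] at h
    have hd := LinearPMap.mem_domain_of_mem_graph h
    refine ⟨hd, ?_⟩
    rw [← (LinearPMap.image_iff hd).2 h]
    module
  · have hy := (L σ).mem_graph y
    rw [L_graph] at hy
    -- The difference `R (L - z) y - y` lies in the kernel of `L - z`, which is trivial.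
    have h := (graph σ).sub_mem (hR (L σ y - z • (y : L2 b))) hy
    refine sub_eq_zero.1 (eq_zero_of_mem_graph_smul hb hz ?_)
    convert h using 1
    rw [Prod.mk_sub_mk, smul_sub]
    congr 1
    module

theorem isEigenvalue_of_Delta_eq_zero (hb : 0 < b) {σ : L2 b} {z : ℂ} (hz : Delta σ z = 0) :
    IsEigenvalue (L σ) z := by
  rw [Delta_eq_boundary] at hz
  have h := expPoly_mem_graph σ z (X ^ 0) hz
  rw [← L_graph] at h
  have hd := LinearPMap.mem_domain_of_mem_graph h
  refine ⟨⟨_, hd⟩, fun h0 => ?_, ?_⟩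
  · exact pow_ne_zero 0 X_ne_zero (expPoly_injective hb z (h0.trans (map_zero _).symm))
  · rw [← (LinearPMap.image_iff hd).2 h, ← map_smul, smul_eq_C_mul]
    simp

theorem IsEigenvalue.mem_spectrum {E : Type*} [NormedAddCommGroup E] [NormedSpace ℂ E]
    {A : E →ₗ.[ℂ] E} {z : ℂ} (h : IsEigenvalue A z) : z ∈ spectrum A := by
  rintro ⟨R, -, hR⟩
  obtain ⟨y, hy, hAy⟩ := h
  refine hy ?_
  rw [← hR y, hAy, sub_self, map_zero]

theorem spectrum_eq (hb : 0 < b) (σ : L2 b) : spectrum (L σ) = {z | Delta σ z = 0} := by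
  ext z
  refine ⟨fun h => ?_, fun h => (isEigenvalue_of_Delta_eq_zero hb h).mem_spectrum⟩
  by_contra hz
  exact h (mem_resolventSet_of_Delta_ne_zero hb hz)

end Resolvent

end SegmentOperator

theorem theorem1p2 (b : ℝ) (hb : 0 < b) (σ : SegmentOperator.L2 b) :
    Differentiable ℂ (SegmentOperator.Delta σ) ∧
    SegmentOperator.spectrum (SegmentOperator.L σ) = {z : ℂ | SegmentOperator.Delta σ z = 0} ∧
    (∀ z ∈ SegmentOperator.spectrum (SegmentOperator.L σ),
      SegmentOperator.IsEigenvalue (SegmentOperator.L σ) z) ∧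
    ∀ z : ℂ, analyticOrderAt (SegmentOperator.Delta σ) z ≠ ⊤ ∧
      SegmentOperator.algMultiplicity (SegmentOperator.L σ) z =
        analyticOrderAt (SegmentOperator.Delta σ) z := by
  refine ⟨SegmentOperator.differentiable_Delta σ, SegmentOperator.spectrum_eq hb σ,
    fun z hz => ?_, fun z => ⟨SegmentOperator.analyticOrderAt_Delta_ne_top σ z,
      SegmentOperator.algMultiplicity_eq_analyticOrderAt hb σ z⟩⟩
  rw [SegmentOperator.spectrum_eq hb σ] at hz
  exact SegmentOperator.isEigenvalue_of_Delta_eq_zero hb hz
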